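/- Let $G$ be a finite group that has a non-abelian Sylow $p$-subgroup for some prime $p$. A non-abelian finite group is called minimal non-abelian if all its proper subgroups are abelian. Let $\alpha_1(G)$ be the number of minimal non-abelian subgroups of $G$, and let $\kappa_1(G)$ be the number of conjugacy classes of such subgroups, i.e. the number of orbits of $G$ acting by conjugation on the set of all minimal non-abelian subgroups of $G$. Then $\kappa_1(G)=1$ if and only if $\alpha_1(G)=1$. -/

import Mathlib

open scoped Pointwise

/-- A group is minimal non-abelian if it is non-abelian and all its proper subgroups are abelian
(used here for finite groups only). -/
def IsMinimalNonabelian (H : Type*) [Group H] : Prop :=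
  ¬ IsMulCommutative H ∧ ∀ K : Subgroup H, K ≠ ⊤ → IsMulCommutative K

theorem IsMinimalNonabelian.of_mulEquiv {H K : Type*} [Group H] [Group K] (e : H ≃* K)
    (h : IsMinimalNonabelian H) : IsMinimalNonabelian K := by
  refine ⟨fun hK => h.1 ⟨⟨fun a b => e.injective ?_⟩⟩, fun L hL => ?_⟩
  · rw [map_mul, map_mul, hK.is_comm.comm]
  · have hne : L.comap e.toMonoidHom ≠ ⊤ := by
      intro ht
      refine hL (eq_top_iff.2 fun x _ => ?_)
      have hx : e.symm x ∈ L.comap e.toMonoidHom := ht ▸ Subgroup.mem_top _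
      simpa using hx
    have hc := h.2 _ hne
    refine ⟨⟨fun a b => Subtype.ext ?_⟩⟩
    have hmem : ∀ x : L, e.symm (x : K) ∈ L.comap e.toMonoidHom := fun x => by simp
    have hab : e.symm (a : K) * e.symm (b : K) = e.symm (b : K) * e.symm (a : K) :=
      congrArg Subtype.val
      (hc.is_comm.comm ⟨e.symm (a : K), hmem a⟩ ⟨e.symm (b : K), hmem b⟩)
    apply e.symm.injective
    rw [Subgroup.coe_mul, Subgroup.coe_mul, map_mul, map_mul, hab]

/-- The set of all minimal non-abelian subgroups of `G`, as a set on which `G` acts by conjugation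
(`ConjAct G` is `G` acting by `g • H = g H g⁻¹`). -/
def minimalNonabelianSubgroups (G : Type*) [Group G] : SubMulAction (ConjAct G) (Subgroup G) where
  carrier := {H | IsMinimalNonabelian H}
  smul_mem' g _ hH := hH.of_mulEquiv (Subgroup.equivSMul g _)

/-- `α₁(G)`: the number of minimal non-abelian subgroups of `G`. -/
noncomputable def alphaOne (G : Type*) [Group G] : ℕ :=
  Nat.card (minimalNonabelianSubgroups G)

/-- `κ₁(G)`: the number of conjugacy classes of minimal non-abelian subgroups of `G`, that is, the
number of orbits of `G` acting by conjugation on the set of these subgroups. -/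
noncomputable def kappaOne (G : Type*) [Group G] : ℕ :=
  Nat.card (MulAction.orbitRel.Quotient (ConjAct G) (minimalNonabelianSubgroups G))

/-! ### Commutativity and minimal non-abelianness of subgroups -/

open scoped commutatorElement

/-! Only the passage from one conjugacy class to one subgroup needs work. A non-abelian Sylow
`p`-subgroup `P` contains a minimal non-abelian subgroup, so all of them are `p`-groups. Burnside
transfer at every prime `q ≠ p` then makes `P` normal (`Sylow.normal_of_forall_exists_isPGroup_le`),
and Schur–Zassenhaus gives a complement `H`, which is abelian because every minimal non-abelian
subgroup lies in `P`. The goal is that `P` itself is minimal non-abelian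
(`eq_of_isMinimalNonabelian`).

Since `P` is generated by its minimal non-abelian subgroups, a normal subgroup of `G` properly
inside `P` cannot contain the whole class, and so is abelian. If `H` centralizes `P`, maximal
subgroups of `P` are normal in `G`, hence abelian, and the goal follows.

Otherwise coprime action makes every such normal subgroup central (`le_center_of_lt`). With `Z =
Z(G) ∩ P`, transfer and conjugacy show that `Z` has order `p` and contains all commutators and
`p`-th powers of `P`; the minimal non-abelian subgroups are the groups `⟨x, y⟩` with `x, y ∈ P` not
commuting, all of order `p ^ 3`. An element of `H` fixing one non-central element of `P` centralizes
`P`. Counting the subgroups `⟨a, y⟩` through a fixed non-central `a` gives `|P| ≤ p ^ 3 * (p ^ 2 -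
1) < p ^ 5`, whereas a minimal non-abelian `A ≠ P` forces `|P| ≥ p ^ 5` (`pow_five_le_card`). -/

theorem Subgroup.isMulCommutative_iff_forall_mem {G : Type*} [Group G] {K : Subgroup G} :
    IsMulCommutative K ↔ ∀ x ∈ K, ∀ y ∈ K, x * y = y * x := by
  refine ⟨fun h x hx y hy => congrArg Subtype.val (h.is_comm.comm ⟨x, hx⟩ ⟨y, hy⟩), fun h => ?_⟩
  exact ⟨⟨fun a b => Subtype.ext (h a a.2 b b.2)⟩⟩

theorem Subgroup.not_isMulCommutative_iff {G : Type*} [Group G] {K : Subgroup G} :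
    ¬ IsMulCommutative K ↔ ∃ x ∈ K, ∃ y ∈ K, x * y ≠ y * x := by
  rw [Subgroup.isMulCommutative_iff_forall_mem]
  push Not
  rfl

theorem Subgroup.isMulCommutative_of_le {G : Type*} [Group G] {K L : Subgroup G}
    (hL : IsMulCommutative L) (h : K ≤ L) : IsMulCommutative K := by
  rw [Subgroup.isMulCommutative_iff_forall_mem] at hL ⊢
  exact fun x hx y hy => hL x (h hx) y (h hy)

theorem isMinimalNonabelian_subgroup_iff {G : Type*} [Group G] {B : Subgroup G} :
    IsMinimalNonabelian B ↔ ¬ IsMulCommutative B ∧ ∀ K < B, IsMulCommutative K := by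
  refine and_congr_right fun _ => ⟨fun h K hK => ?_, fun h K hK => ?_⟩
  · have := h (K.subgroupOf B) (by rw [Ne, Subgroup.subgroupOf_eq_top]; exact not_le_of_gt hK)
    rw [Subgroup.isMulCommutative_iff_forall_mem] at this ⊢
    intro x hx y hy
    exact congrArg Subtype.val (this ⟨x, hK.le hx⟩ hx ⟨y, hK.le hy⟩ hy)
  · have hlt : K.map B.subtype < B := by
      refine lt_of_le_of_ne (Subgroup.map_subtype_le K) fun he => hK ?_
      rw [eq_top_iff]
      intro x _
      have hx : (x : G) ∈ K.map B.subtype := he.ge x.2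
      obtain ⟨y, hy, hyx⟩ := hx
      exact Subtype.ext hyx ▸ hy
    have := h _ hlt
    rw [Subgroup.isMulCommutative_iff_forall_mem] at this ⊢
    intro x hx y hy
    exact Subtype.ext (this x ⟨x, hx, rfl⟩ y ⟨y, hy, rfl⟩)

/-! ### Maximal subgroups of `p`-groups and generation by minimal non-abelian subgroups -/

theorem IsPGroup.mem_of_zpow_mem {K : Type*} [Group K] {p : ℕ} (hK : IsPGroup p K)
    (hp : p.Prime) {M : Subgroup K} {g : K} {i : ℤ} (hi : ¬ (p : ℤ) ∣ i) (hg : g ^ i ∈ M) :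
    g ∈ M := by
  obtain ⟨k, hk⟩ := hK g
  have hc : IsCoprime i ((p : ℤ) ^ k) :=
    (((Nat.prime_iff_prime_int.1 hp).coprime_iff_not_dvd.2 hi).symm).pow_right
  obtain ⟨a, b, hab⟩ := hc
  have h1 : g = (g ^ i) ^ a * (g ^ (p ^ k)) ^ b := by
    rw [← zpow_natCast g, ← zpow_mul, ← zpow_mul, ← zpow_add]
    push_cast
    rw [mul_comm i a, mul_comm _ b, hab, zpow_one]
  rw [h1, hk, one_zpow, mul_one]
  exact M.zpow_mem hg a

theorem exists_zpow_mul_of_isCoatom {K : Type*} [Group K] {M : Subgroup K} [M.Normal]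
    (hM : IsCoatom M) {x : K} (hx : x ∉ M) (y : K) : ∃ m ∈ M, ∃ i : ℤ, y = m * x ^ i := by
  have ht : M ⊔ Subgroup.zpowers x = ⊤ :=
    hM.2 _ (lt_of_le_of_ne le_sup_left fun h => hx (h ▸
      (le_sup_right : Subgroup.zpowers x ≤ _) (Subgroup.mem_zpowers x)))
  have hy : y ∈ M ⊔ Subgroup.zpowers x := ht ▸ Subgroup.mem_top y
  obtain ⟨m, hm, z, ⟨i, rfl⟩, h⟩ := Subgroup.mem_sup_of_normal_left.1 hy
  exact ⟨m, hm, i, h.symm⟩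

theorem IsPGroup.pow_mem_of_isCoatom {K : Type*} [Group K] {p : ℕ} (hK : IsPGroup p K)
    (hp : p.Prime) {M : Subgroup K} [M.Normal] (hM : IsCoatom M) (g : K) : g ^ p ∈ M := by
  by_contra hg
  obtain ⟨m, hm, i, h⟩ := exists_zpow_mul_of_isCoatom hM hg g
  refine hg (M.pow_mem (hK.mem_of_zpow_mem hp (i := 1 - p * i) ?_ ?_) p)
  · intro hd
    have : (p : ℤ) ∣ 1 := (dvd_sub_left (dvd_mul_right _ _)).1 hd
    exact hp.one_lt.ne' (Nat.dvd_one.1 (by exact_mod_cast this))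
  · rw [zpow_sub, zpow_one, zpow_mul, zpow_natCast]
    nth_rewrite 1 [h]
    simpa using hm

/-- In a non-abelian finite `p`-group, if all proper subgroups outside a proper subgroup `M` are
abelian, then all proper subgroups are abelian. -/
theorem IsPGroup.isMulCommutative_of_ne_top {K : Type*} [Group K] [Finite K] {p : ℕ}
    (hK : IsPGroup p K) (hp : p.Prime) (hnc : ∃ a b : K, a * b ≠ b * a) {M : Subgroup K}
    (hM : M ≠ ⊤) (h : ∀ L : Subgroup K, L ≠ ⊤ → ¬ L ≤ M → IsMulCommutative L) :
    ∀ L : Subgroup K, L ≠ ⊤ → IsMulCommutative L := by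
  have := Fact.mk hp
  have hnil := hK.isNilpotent
  have hnorm : ∀ N : Subgroup K, IsCoatom N → N.Normal := fun N hN =>
    Subgroup.NormalizerCondition.normal_of_coatom N Group.normalizerCondition_of_isNilpotent hN
  wlog hMc : IsCoatom M generalizing M
  · obtain ⟨M', hM', hle⟩ := (eq_top_or_exists_le_coatom M).resolve_left hM
    exact this hM'.1 (fun L h1 h2 => h L h1 fun h3 => h2 (h3.trans hle)) hM'
  have hMn := hnorm M hMc
  -- The elements outside a proper subgroup generate the group, so they cannot all be central.
  obtain ⟨x, hxM, y₀, hxy₀⟩ : ∃ x ∉ M, ∃ y, x * y ≠ y * x := by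
    by_contra! hcon
    obtain ⟨x, hx⟩ : ∃ x, x ∉ M := by
      by_contra! hall
      exact hM (eq_top_iff.2 fun x _ => hall x)
    obtain ⟨a, b, hab⟩ := hnc
    by_cases ha : a ∈ M
    · have h1 := hcon (x * a) (fun hxa => hx ((M.mul_mem_cancel_right ha).1 hxa)) b
      have h2 := hcon x hx b
      rw [mul_assoc, ← mul_assoc b, ← h2, mul_assoc] at h1
      exact hab (mul_left_cancel h1)
    · exact hab (hcon a ha b)
  obtain ⟨y, hyM, i, rfl⟩ := exists_zpow_mul_of_isCoatom hMc hxM y₀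
  have hxy : x * y ≠ y * x := by
    intro he
    exact hxy₀ (Commute.mul_right (show Commute x y from he) (Commute.self_zpow x i))
  obtain ⟨T, hT, hxT⟩ : ∃ T : Subgroup K, IsCoatom T ∧ x ∈ T := by
    rcases eq_top_or_exists_le_coatom (Subgroup.zpowers x) with ht | ⟨T, hT, hle⟩
    · have hy : y ∈ Subgroup.zpowers x := ht ▸ Subgroup.mem_top y
      obtain ⟨j, rfl⟩ := hy
      exact absurd (Commute.self_zpow x j) hxy
    · exact ⟨T, hT, hle (Subgroup.mem_zpowers x)⟩
  have hTn := hnorm T hT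
  have hTc := Subgroup.isMulCommutative_iff_forall_mem.1 (h T hT.1 fun hle => hxM (hle hxT))
  have hyT : y ∉ T := fun hy => hxy (hTc x hxT y hy)
  -- If `d` and `y` do not commute, neither do `d` and `x * y`, so these two generate `K` and `K =
  -- (M ⊓ T)⟨x * y⟩`. Writing `x = e * (x * y) ^ j` and reducing modulo `T` gives `y ^ j ∈ T`, hence
  -- `p ∣ j`; then `(x * y) ^ j ∈ M` and `x ∈ M`, a contradiction.
  have hDy : ∀ d ∈ M ⊓ T, d * y = y * d := by
    rintro d ⟨hdM, hdT⟩
    by_contra hdy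
    have hL : Subgroup.closure {x * y, d} = ⊤ := by
      by_contra hL
      have hc := h _ hL fun hle => hxM ((M.mul_mem_cancel_right hyM).1
        (hle (Subgroup.subset_closure (by simp))))
      rw [Subgroup.isMulCommutative_iff_forall_mem] at hc
      have h1 := hc (x * y) (Subgroup.subset_closure (by simp)) d (Subgroup.subset_closure (by
        simp))
      rw [← mul_assoc, ← hTc x hxT d hdT, mul_assoc, mul_assoc] at h1
      exact hdy (mul_left_cancel h1).symm
    have hle : Subgroup.closure {x * y, d} ≤ (M ⊓ T) ⊔ Subgroup.zpowers (x * y) := by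
      rw [Subgroup.closure_le, Set.insert_subset_iff, Set.singleton_subset_iff]
      exact ⟨(le_sup_right : Subgroup.zpowers (x * y) ≤ _) (Subgroup.mem_zpowers _),
        (le_sup_left : M ⊓ T ≤ _) ⟨hdM, hdT⟩⟩
    have hx' : x ∈ (M ⊓ T) ⊔ Subgroup.zpowers (x * y) := hle (hL ▸ Subgroup.mem_top x)
    obtain ⟨e, ⟨heM, heT⟩, z, ⟨j, rfl⟩, hez⟩ := Subgroup.mem_sup_of_normal_left.1 hx'
    have hzT : (x * y) ^ j ∈ T := (T.mul_mem_cancel_left heT).1 (by simpa [hez] using hxT)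
    have hyj : y ^ j ∈ T := by
      rw [← QuotientGroup.eq_one_iff] at hzT hxT ⊢
      simpa [hxT] using hzT
    have hpj : (p : ℤ) ∣ j := by
      by_contra hpj
      exact hyT (hK.mem_of_zpow_mem hp hpj hyj)
    obtain ⟨k, rfl⟩ := hpj
    refine hxM (hez ▸ M.mul_mem heM ?_)
    simp only [zpow_mul, zpow_natCast]
    exact M.zpow_mem (hK.pow_mem_of_isCoatom hp hMc _) k
  -- `M` is generated by `M ⊓ T`, which is abelian and commutes with `y`, together with `y`.
  have hMcomm : IsMulCommutative M := by
    have key : ∀ m ∈ M, ∃ d ∈ M ⊓ T, ∃ j : ℤ, m = d * y ^ j := by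
      intro m hm
      obtain ⟨t, ht, j, rfl⟩ := exists_zpow_mul_of_isCoatom hT hyT m
      exact ⟨t, ⟨(M.mul_mem_cancel_right (M.zpow_mem hyM j)).1 hm, ht⟩, j, rfl⟩
    rw [Subgroup.isMulCommutative_iff_forall_mem]
    intro u hu v hv
    obtain ⟨d, hd, j, rfl⟩ := key u hu
    obtain ⟨e, he, k, rfl⟩ := key v hv
    have hdy : Commute d y := hDy d hd
    have hey : Commute e y := hDy e he
    have hde : Commute d e := hTc d hd.2 e he.2
    exact (hde.mul_right (hdy.zpow_right k)).mul_left
      ((hey.symm.zpow_left j).mul_right ((Commute.refl y).zpow_zpow j k))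
  intro L hL
  by_cases hLM : L ≤ M
  · exact Subgroup.isMulCommutative_of_le hMcomm hLM
  · exact h L hL hLM

theorem Subgroup.exists_isMinimalNonabelian_le {G : Type*} [Group G] [Finite G] {K : Subgroup G}
    (hK : ¬ IsMulCommutative K) : ∃ B ≤ K, IsMinimalNonabelian B := by
  obtain ⟨B, hB, hmin⟩ :=
    Set.Finite.exists_minimal (Set.toFinite {L : Subgroup G | L ≤ K ∧ ¬ IsMulCommutative L})
      ⟨K, le_rfl, hK⟩
  refine ⟨B, hB.1, isMinimalNonabelian_subgroup_iff.2 ⟨hB.2, fun L hL => ?_⟩⟩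
  by_contra hc
  exact not_le_of_gt hL (hmin ⟨hL.le.trans hB.1, hc⟩ hL.le)

/-- A finite non-abelian `p`-group is generated by its minimal non-abelian subgroups. -/
theorem IsPGroup.exists_isMinimalNonabelian_not_le {G : Type*} [Group G] [Finite G] {p : ℕ}
    (hp : p.Prime) {K M : Subgroup G} (hKp : IsPGroup p K) (hK : ¬ IsMulCommutative K)
    (hM : ¬ K ≤ M) : ∃ B ≤ K, IsMinimalNonabelian B ∧ ¬ B ≤ M := by
  obtain ⟨B, ⟨hBK, hBn, hBM⟩, hmin⟩ :=
    Set.Finite.exists_minimal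
      (Set.toFinite {L : Subgroup G | L ≤ K ∧ ¬ IsMulCommutative L ∧ ¬ L ≤ M})
      ⟨K, le_rfl, hK, hM⟩
  refine ⟨B, hBK, ⟨hBn, ?_⟩, hBM⟩
  refine (hKp.to_le hBK).isMulCommutative_of_ne_top hp (M := M.subgroupOf B) ?_ ?_ ?_
  · by_contra! hc
    exact hBn ⟨⟨hc⟩⟩
  · rwa [Ne, Subgroup.subgroupOf_eq_top]
  · intro L hL hLM
    by_contra hc
    have hle : L.map B.subtype ≤ B := Subgroup.map_subtype_le L
    refine hL (eq_top_iff.2 fun x _ => ?_)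
    have hx : (x : G) ∈ L.map B.subtype := by
      refine hmin (y := L.map B.subtype) ⟨hle.trans hBK, ?_, ?_⟩ hle x.2
      · rw [Subgroup.not_isMulCommutative_iff] at hc ⊢
        obtain ⟨a, ha, b, hb, hab⟩ := hc
        exact ⟨a, ⟨a, ha, rfl⟩, b, ⟨b, hb, rfl⟩, fun he => hab (Subtype.ext he)⟩
      · intro h2
        exact hLM fun z hz => h2 ⟨z, hz, rfl⟩
    obtain ⟨y, hy, hyx⟩ := hx
    exact Subtype.ext hyx ▸ hy

/-! ### Cyclic extensions and normality of the Sylow subgroup -/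

theorem Subgroup.mem_sup_zpowers_iff {G : Type*} [Group G] {N : Subgroup G} {g : G}
    (hg : g ∈ Subgroup.normalizer (N : Set G)) {x : G} :
    x ∈ N ⊔ Subgroup.zpowers g ↔ ∃ m ∈ N, ∃ i : ℤ, x = m * g ^ i := by
  have hle : Subgroup.zpowers g ≤ Subgroup.normalizer (N : Set G) := by
    rwa [Subgroup.zpowers_le]
  rw [← SetLike.mem_coe, Subgroup.coe_mul_of_right_le_normalizer_left N _ hle, Set.mem_mul]
  constructor
  · rintro ⟨m, hm, _, ⟨i, rfl⟩, h⟩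
    exact ⟨m, hm, i, h.symm⟩
  · rintro ⟨m, hm, i, h⟩
    exact ⟨m, hm, g ^ i, ⟨i, rfl⟩, h.symm⟩

theorem Subgroup.commutatorElement_mem_of_mem_sup_zpowers {G : Type*} [Group G] {N : Subgroup G}
    {g : G} (hg : g ∈ Subgroup.normalizer (N : Set G)) {x y : G}
    (hx : x ∈ N ⊔ Subgroup.zpowers g) (hy : y ∈ N ⊔ Subgroup.zpowers g) : ⁅x, y⁆ ∈ N := by
  obtain ⟨m, hm, i, rfl⟩ := (Subgroup.mem_sup_zpowers_iff hg).1 hx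
  obtain ⟨n, hn, j, rfl⟩ := (Subgroup.mem_sup_zpowers_iff hg).1 hy
  have hle : N ≤ Subgroup.normalizer (N : Set G) := Subgroup.le_normalizer
  let m' : Subgroup.normalizer (N : Set G) := ⟨m, hle hm⟩
  let n' : Subgroup.normalizer (N : Set G) := ⟨n, hle hn⟩
  let g' : Subgroup.normalizer (N : Set G) := ⟨g, hg⟩
  have key : ⁅m' * g' ^ i, n' * g' ^ j⁆ ∈ N.subgroupOf (Subgroup.normalizer (N : Set G)) := by
    have hm' : (m' : (Subgroup.normalizer (N : Set G)) ⧸ N.subgroupOf _) = 1 :=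
      (QuotientGroup.eq_one_iff _).2 hm
    have hn' : (n' : (Subgroup.normalizer (N : Set G)) ⧸ N.subgroupOf _) = 1 :=
      (QuotientGroup.eq_one_iff _).2 hn
    rw [← QuotientGroup.eq_one_iff, ← QuotientGroup.mk'_apply, map_commutatorElement]
    simp only [map_mul, map_zpow, QuotientGroup.mk'_apply, hm', hn', one_mul]
    exact commutatorElement_eq_one_iff_commute.2 ((Commute.refl _).zpow_zpow i j)
  exact key

/-- If every non-abelian subgroup contains a non-abelian `p`-subgroup, then the Sylow
`p`-subgroup is normal. -/
theorem Sylow.normal_of_forall_exists_isPGroup_le {G : Type*} [Group G] [Finite G] {p : ℕ}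
    [Fact p.Prime] (P : Sylow p G)
    (h : ∀ K : Subgroup G, ¬ IsMulCommutative K →
      ∃ B ≤ K, IsPGroup p B ∧ ¬ IsMulCommutative B) : (P : Subgroup G).Normal := by
  have hnc : ∀ q : ℕ, q.Prime → q ≠ p → ∀ Q : Sylow q G,
      Subgroup.normalizer (Q : Set G) ≤ Subgroup.centralizer (Q : Set G) := by
    intro q hq hqp Q g hg
    have := Fact.mk hq
    -- Commutators in `Q⟨g⟩` lie in the `q`-group `Q`, so those of a `p`-subgroup are trivial.
    have hK : IsMulCommutative ((Q : Subgroup G) ⊔ Subgroup.zpowers g : Subgroup G) := by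
      by_contra hK
      obtain ⟨B, hBK, hBp, hBn⟩ := h _ hK
      refine hBn (Subgroup.isMulCommutative_iff_forall_mem.2 fun x hx y hy => ?_)
      have h1 : ⁅x, y⁆ ∈ (Q : Subgroup G) :=
        Subgroup.commutatorElement_mem_of_mem_sup_zpowers hg (hBK hx) (hBK hy)
      have h2 : ⁅x, y⁆ ∈ B :=
        B.mul_mem (B.mul_mem (B.mul_mem hx hy) (B.inv_mem hx)) (B.inv_mem hy)
      have hd := IsPGroup.disjoint_of_ne q p hqp _ _ Q.isPGroup' hBp
      exact commutatorElement_eq_one_iff_mul_comm.1 (Subgroup.disjoint_def.1 hd h1 h2)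
    rw [Subgroup.isMulCommutative_iff_forall_mem] at hK
    intro x hx
    exact hK x ((le_sup_left : (Q : Subgroup G) ≤ _) hx) g
      ((le_sup_right : Subgroup.zpowers g ≤ _) (Subgroup.mem_zpowers g))
  -- Burnside: the kernel of the transfer into `Q` is a normal `q`-complement. It contains `P`,
  -- whose image in a `q`-group is trivial. The intersection over all `q ≠ p` is a normal `p`-group
  -- containing `P`, hence `P` itself.
  have hN : ∀ q : {q : ℕ // q.Prime ∧ q ≠ p}, ∃ N : Subgroup G, N.Normal ∧
      (P : Subgroup G) ≤ N ∧ ¬ q.1 ∣ Nat.card N := by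
    rintro ⟨q, hq, hqp⟩
    have := Fact.mk hq
    let Q : Sylow q G := default
    refine ⟨(MonoidHom.transferSylow Q (hnc q hq hqp Q)).ker, inferInstance, ?_,
      MonoidHom.not_dvd_card_ker_transferSylow Q _⟩
    have hd := IsPGroup.disjoint_of_ne q p hqp _ _ (IsPGroup.to_subgroup Q.isPGroup' ⊤)
      (P.isPGroup'.map (MonoidHom.transferSylow Q (hnc q hq hqp Q)))
    rw [top_disjoint, Subgroup.map_eq_bot_iff] at hd
    exact hd
  choose N hN hPN hqN using hN
  have hP : (P : Subgroup G) ≤ ⨅ q, N q := le_iInf hPN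
  have hp : IsPGroup p (⨅ q, N q : Subgroup G) := by
    refine IsPGroup.of_card (n := (Nat.card (⨅ q, N q : Subgroup G)).primeFactorsList.length)
      (Nat.eq_prime_pow_of_unique_prime_dvd Nat.card_pos.ne' fun {q} hq hdvd => ?_)
    by_contra hqp
    exact hqN ⟨q, hq, hqp⟩ (hdvd.trans (Subgroup.card_dvd_of_le (iInf_le N ⟨q, hq, hqp⟩)))
  rw [← P.is_maximal' hp hP]
  exact Subgroup.normal_iInf_normal hN

/-! ### The split situation: normal subgroups of `G` inside `P` -/

/-- A finite group with non-abelian normal Sylow `p`-subgroup `P` complemented by `H`, whose minimal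
non-abelian subgroups all lie in `P` and form a single conjugacy class. -/
structure IsOneClassSplit {G : Type*} [Group G] (p : ℕ) (P H : Subgroup G) : Prop where
  normal : P.Normal
  isPGroup : IsPGroup p P
  not_isMulCommutative : ¬ IsMulCommutative P
  isComplement : Subgroup.IsComplement' P H
  coprime : (Nat.card P).Coprime (Nat.card H)
  le : ∀ A : Subgroup G, IsMinimalNonabelian A → A ≤ P
  conj : ∀ A B : Subgroup G, IsMinimalNonabelian A → IsMinimalNonabelian B →
    ∃ g : G, ∀ x, x ∈ A ↔ g * x * g⁻¹ ∈ B

theorem commutatorElement_pow_left_of_commute {G : Type*} [Group G] {h x : G}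
    (hc : Commute h ⁅h, x⁆) (n : ℕ) : ⁅h ^ n, x⁆ = ⁅h, x⁆ ^ n := by
  induction n with
  | zero => simp
  | succ n ih =>
    rw [pow_succ' h n, commutatorElement_mul_left_eq_conj_mul, ih, pow_succ, (hc.pow_right n).eq,
      mul_inv_cancel_right]

namespace IsOneClassSplit

variable {G : Type*} [Group G] {p : ℕ} {P H : Subgroup G}

theorem eq_one_of_mem (S : IsOneClassSplit p P H) {x : G} (hP : x ∈ P) (hH : x ∈ H) : x = 1 :=
  Subgroup.disjoint_def.1 S.isComplement.disjoint hP hH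

theorem exists_mul_eq (S : IsOneClassSplit p P H) (g : G) : ∃ u ∈ P, ∃ h ∈ H, g = h * u := by
  have := S.normal
  have hg : g ∈ P ⊔ H := S.isComplement.sup_eq_top ▸ Subgroup.mem_top g
  rw [sup_comm] at hg
  obtain ⟨h, hh, u, hu, rfl⟩ := Subgroup.mem_sup_of_normal_right.1 hg
  exact ⟨u, hu, h, hh, rfl⟩

theorem normal_of_conj_mem (S : IsOneClassSplit p P H) {M : Subgroup G}
    (hP : ∀ u ∈ P, ∀ x ∈ M, u * x * u⁻¹ ∈ M) (hH : ∀ h ∈ H, ∀ x ∈ M, h * x * h⁻¹ ∈ M) :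
    M.Normal := by
  refine ⟨fun x hx g => ?_⟩
  obtain ⟨u, hu, h, hh, rfl⟩ := S.exists_mul_eq g
  have := hH h hh _ (hP u hu x hx)
  simpa [mul_assoc] using this

theorem commute_of_mem_complement [Finite G] (S : IsOneClassSplit p P H) {h k : G} (hh : h ∈ H)
    (hk : k ∈ H) :
    Commute h k := by
  have hc : IsMulCommutative H := by
    by_contra hc
    obtain ⟨B, hB, hBm⟩ := Subgroup.exists_isMinimalNonabelian_le hc
    refine hBm.1 (Subgroup.isMulCommutative_iff_forall_mem.2 fun x hx y hy => ?_)
    rw [S.eq_one_of_mem (S.le B hBm hx) (hB hx), one_mul, mul_one]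
  exact Subgroup.isMulCommutative_iff_forall_mem.1 hc h hh k hk

/-- A non-abelian normal `M` would contain one minimal non-abelian subgroup, hence by conjugacy all
of them; but some minimal non-abelian subgroup of `P` lies outside `M`. -/
theorem isMulCommutative_of_lt [Finite G] (S : IsOneClassSplit p P H)
    (hp : p.Prime) {M : Subgroup G}
    (hMn : M.Normal) (hM : M < P) : IsMulCommutative M := by
  by_contra hc
  obtain ⟨A, hAM, hA⟩ := Subgroup.exists_isMinimalNonabelian_le hc
  obtain ⟨B, -, hB, hBM⟩ := S.isPGroup.exists_isMinimalNonabelian_not_le hp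
    S.not_isMulCommutative (not_le_of_gt hM)
  obtain ⟨g, hg⟩ := S.conj B A hB hA
  refine hBM fun x hx => ?_
  have := hMn.conj_mem _ (hAM ((hg x).1 hx)) g⁻¹
  simpa [mul_assoc] using this

/-- A minimal non-abelian subgroup of `M⟨k⟩` would lie in `M⟨k⟩ ∩ P = M`, which is abelian. -/
theorem commute_of_mem_normalizer [Finite G] (S : IsOneClassSplit p P H) {M : Subgroup G}
    (hM : M ≤ P)
    (hMc : IsMulCommutative M) {k : G} (hk : k ∈ H)
    (hkM : k ∈ Subgroup.normalizer (M : Set G)) {x : G} (hx : x ∈ M) : Commute k x := by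
  have hc : IsMulCommutative (M ⊔ Subgroup.zpowers k : Subgroup G) := by
    by_contra hc
    obtain ⟨B, hB, hBm⟩ := Subgroup.exists_isMinimalNonabelian_le hc
    refine hBm.1 (Subgroup.isMulCommutative_of_le hMc fun y hy => ?_)
    obtain ⟨m, hm, i, rfl⟩ := (Subgroup.mem_sup_zpowers_iff hkM).1 (hB hy)
    have h1 : k ^ i ∈ P := (P.mul_mem_cancel_left (hM hm)).1 (S.le B hBm hy)
    rwa [S.eq_one_of_mem h1 (H.zpow_mem hk i), mul_one]
  exact Subgroup.isMulCommutative_iff_forall_mem.1 hc k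
    ((le_sup_right : Subgroup.zpowers k ≤ _) (Subgroup.mem_zpowers k)) x
    ((le_sup_left : M ≤ _) hx)

theorem commute_of_normal [Finite G] (S : IsOneClassSplit p P H) {M : Subgroup G} (hM : M ≤ P)
    (hMc : IsMulCommutative M) (hMn : M.Normal) {k : G} (hk : k ∈ H) {x : G} (hx : x ∈ M) :
    Commute k x :=
  S.commute_of_mem_normalizer hM hMc hk (Subgroup.normalizer_eq_top_iff.2 hMn ▸ Subgroup.mem_top
    k) hx

/-- Coprime action: here `⁅h, x⁆ ^ n = ⁅h ^ n, x⁆`, so the order of `⁅h, x⁆` divides `|H|`; it also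
divides `|P|`. -/
theorem commute_of_commute_commutatorElement (S : IsOneClassSplit p P H) {x h : G} (hx : x ∈ P)
    (hh : h ∈ H) (hc : Commute h ⁅h, x⁆) : Commute h x := by
  have hcP : ⁅h, x⁆ ∈ P := P.mul_mem (S.normal.conj_mem x hx h) (P.inv_mem hx)
  have h1 := commutatorElement_pow_left_of_commute hc (Nat.card H)
  have hhH : h ^ Nat.card H = 1 :=
    congrArg Subtype.val (pow_card_eq_one' (x := (⟨h, hh⟩ : H)))
  have hcc : ⁅h, x⁆ ^ Nat.card P = 1 :=
    congrArg Subtype.val (pow_card_eq_one' (x := (⟨⁅h, x⁆, hcP⟩ : P)))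
  rw [hhH, commutatorElement_one_left] at h1
  have h2 : orderOf ⁅h, x⁆ ∣ 1 := by
    rw [← S.coprime.gcd_eq_one]
    exact Nat.dvd_gcd (orderOf_dvd_of_pow_eq_one hcc) (orderOf_dvd_of_pow_eq_one h1.symm)
  exact commutatorElement_eq_one_iff_commute.1 (orderOf_eq_one_iff.1 (Nat.dvd_one.1 h2))

/-- If the complement centralizes `P`, then `P` is minimal non-abelian. -/
theorem eq_of_forall_commute [Finite G] (S : IsOneClassSplit p P H) (hp : p.Prime)
    (hc : ∀ h ∈ H, ∀ x ∈ P, Commute h x) {A : Subgroup G} (hA : IsMinimalNonabelian A) :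
    A = P := by
  have := Fact.mk hp
  have hAP := S.le A hA
  by_contra hne
  have hsub : A.subgroupOf P ≠ ⊤ := by
    rw [Ne, Subgroup.subgroupOf_eq_top]
    exact fun h => hne (le_antisymm hAP h)
  obtain ⟨N, hN, hAN⟩ := (eq_top_or_exists_le_coatom (A.subgroupOf P)).resolve_left hsub
  have hnil := S.isPGroup.isNilpotent
  have hNn : N.Normal := Subgroup.NormalizerCondition.normal_of_coatom N
    Group.normalizerCondition_of_isNilpotent hN
  have hMP : N.map P.subtype ≤ P := Subgroup.map_subtype_le N
  have hMn : (N.map P.subtype).Normal := by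
    refine S.normal_of_conj_mem ?_ ?_
    · rintro u hu _ ⟨x, hx, rfl⟩
      exact ⟨⟨u, hu⟩ * x * ⟨u, hu⟩⁻¹, hNn.conj_mem x hx _, rfl⟩
    · intro h hh x hx
      rw [(hc h hh x (hMP hx)).eq, mul_inv_cancel_right]
      exact hx
  have hlt : N.map P.subtype < P := by
    refine lt_of_le_of_ne hMP fun he => hN.1 (eq_top_iff.2 fun x _ => ?_)
    obtain ⟨y, hy, hyx⟩ := he.ge x.2
    exact Subtype.ext hyx ▸ hy
  refine hA.1 (Subgroup.isMulCommutative_of_le (S.isMulCommutative_of_lt hp hMn hlt) fun x hx => ?_)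
  exact ⟨⟨x, hAP hx⟩, hAN hx, rfl⟩

/-- If the complement does not centralize `P`, then every normal subgroup of `G` properly contained
in `P` is central in `G`. -/
theorem le_center_of_lt [Finite G] (S : IsOneClassSplit p P H) (hp : p.Prime)
    (hne : ∃ h ∈ H, ∃ x ∈ P, ¬ Commute h x) {M : Subgroup G} (hMn : M.Normal) (hM : M < P) :
    M ≤ Subgroup.center G := by
  have hMc := S.isMulCommutative_of_lt hp hMn hM
  have hHC : H ≤ Subgroup.centralizer (M : Set G) := fun h hh x hx =>
    (S.commute_of_normal hM.le hMc hMn hh hx).eq.symm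
  have hPC : P ≤ Subgroup.centralizer (M : Set G) := by
    by_contra hPC
    obtain ⟨h, hh, x, hx, hhx⟩ := hne
    have := S.normal
    have hlt : Subgroup.centralizer (M : Set G) ⊓ P < P := inf_lt_right.2 hPC
    have hn : (Subgroup.centralizer (M : Set G) ⊓ P).Normal := inferInstance
    have hcn : (Subgroup.centralizer (M : Set G)).Normal := inferInstance
    -- The commutator `⁅h, x⁆` lies in `C_P(M)`, a proper normal subgroup, hence abelian and
    -- centralized by `H`.
    refine hhx (S.commute_of_commute_commutatorElement hx hh ?_)
    refine S.commute_of_normal hlt.le (S.isMulCommutative_of_lt hp hn hlt) hn hh ⟨?_, ?_⟩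
    · have h1 := hcn.conj_mem h⁻¹ (inv_mem (hHC hh)) x
      have h2 := mul_mem (hHC hh) h1
      simpa [commutatorElement_def, mul_assoc] using h2
    · exact P.mul_mem (S.normal.conj_mem x hx h) (P.inv_mem hx)
  intro x hx
  rw [Subgroup.mem_center_iff]
  intro g
  have hg : g ∈ P ⊔ H := S.isComplement.sup_eq_top ▸ Subgroup.mem_top g
  exact ((sup_le hPC hHC) hg x hx).symm

end IsOneClassSplit

/-! ### Order estimates and two-generator subgroups -/

theorem IsPGroup.mul_card_le_of_lt {G : Type*} [Group G] [Finite G] {p : ℕ} (hp : p.Prime)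
    {K L : Subgroup G} (hL : IsPGroup p L) (hKL : K < L) : p * Nat.card K ≤ Nat.card L := by
  have := Fact.mk hp
  obtain ⟨m, hm⟩ := IsPGroup.iff_card.1 hL
  obtain ⟨n, hn⟩ := IsPGroup.iff_card.1 (hL.to_le hKL.le)
  have hlt : Nat.card K < Nat.card L := by
    by_contra hle
    exact hKL.ne (Subgroup.eq_of_le_of_card_ge hKL.le (not_lt.1 hle))
  rw [hm, hn] at *
  rw [← pow_succ']
  exact Nat.pow_le_pow_right hp.pos ((Nat.pow_lt_pow_iff_right hp.one_lt).1 hlt)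

theorem Subgroup.card_sup_zpowers_le {G : Type*} [Group G] [Finite G] {p : ℕ} (hp : 0 < p)
    {N : Subgroup G} {g : G} (hg : g ∈ Subgroup.normalizer (N : Set G)) (hgp : g ^ p ∈ N) :
    Nat.card (N ⊔ Subgroup.zpowers g : Subgroup G) ≤ p * Nat.card N := by
  have hsurj : Function.Surjective (fun t : Fin p × N =>
      (⟨t.2 * g ^ (t.1 : ℕ), (Subgroup.mem_sup_zpowers_iff hg).2
        ⟨t.2, t.2.2, (t.1 : ℕ), by rw [zpow_natCast]⟩⟩ :
        (N ⊔ Subgroup.zpowers g : Subgroup G))) := by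
    rintro ⟨x, hx⟩
    obtain ⟨m, hm, i, rfl⟩ := (Subgroup.mem_sup_zpowers_iff hg).1 hx
    have hpos : (0 : ℤ) < p := by exact_mod_cast hp
    have h0 := Int.emod_nonneg i hpos.ne'
    have h1 := Int.emod_lt_of_pos i hpos
    refine ⟨(⟨(i % p).toNat, by omega⟩, ⟨m * (g ^ p) ^ (i / p),
      N.mul_mem hm (N.zpow_mem hgp _)⟩), Subtype.ext ?_⟩
    change m * (g ^ p) ^ (i / p) * g ^ (i % p).toNat = m * g ^ i
    rw [← zpow_natCast g (i % p).toNat, Int.toNat_of_nonneg h0, ← zpow_natCast g p, ← zpow_mul,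
      mul_assoc, ← zpow_add, Int.mul_ediv_add_emod]
  have := Nat.card_le_card_of_surjective _ hsurj
  rwa [Nat.card_prod, Nat.card_fin] at this

theorem commutatorElement_mem_of_mem_closure_pair {G : Type*} [Group G] {D : Subgroup G}
    (hD : D.Normal) {x y u v : G} (hxy : ⁅x, y⁆ ∈ D) (hu : u ∈ Subgroup.closure {x, y})
    (hv : v ∈ Subgroup.closure {x, y}) : ⁅u, v⁆ ∈ D := by
  have hc : Commute (QuotientGroup.mk' D x) (QuotientGroup.mk' D y) := by
    rw [← commutatorElement_eq_one_iff_commute, ← map_commutatorElement]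
    exact (QuotientGroup.eq_one_iff _).2 hxy
  have h1 : ∀ w ∈ Subgroup.closure {x, y}, Commute (QuotientGroup.mk' D w) (QuotientGroup.mk' D x) ∧
      Commute (QuotientGroup.mk' D w) (QuotientGroup.mk' D y) := by
    intro w hw
    induction hw using Subgroup.closure_induction with
    | mem w hw =>
      rcases hw with rfl | rfl
      · exact ⟨Commute.refl _, hc⟩
      · exact ⟨hc.symm, Commute.refl _⟩
    | one => simp
    | mul s t _ _ hs ht =>
      rw [map_mul]
      exact ⟨hs.1.mul_left ht.1, hs.2.mul_left ht.2⟩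
    | inv s _ hs =>
      rw [map_inv]
      exact ⟨hs.1.inv_left, hs.2.inv_left⟩
  have h2 : Commute (QuotientGroup.mk' D u) (QuotientGroup.mk' D v) := by
    have hu1 := h1 u hu
    induction hv using Subgroup.closure_induction with
    | mem w hw =>
      rcases hw with rfl | rfl
      · exact hu1.1
      · exact hu1.2
    | one => simp
    | mul s t _ _ hs ht =>
      rw [map_mul]
      exact hs.mul_right ht
    | inv s _ hs =>
      rw [map_inv]
      exact hs.inv_right
  rw [← commutatorElement_eq_one_iff_commute, ← map_commutatorElement] at h2
  exact (QuotientGroup.eq_one_iff _).1 h2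

theorem Subgroup.zpowers_normal_of_mem_center {G : Type*} [Group G] {c : G}
    (hc : c ∈ Subgroup.center G) : (Subgroup.zpowers c).Normal := by
  refine ⟨?_⟩
  rintro _ ⟨i, rfl⟩ g
  have := Subgroup.mem_center_iff.1 (zpow_mem hc i) g
  exact ⟨i, by simp only [this, mul_inv_cancel_right]⟩

theorem IsMinimalNonabelian.eq_closure_pair {G : Type*} [Group G] {A : Subgroup G}
    (hA : IsMinimalNonabelian A) {a b : G} (ha : a ∈ A) (hb : b ∈ A) (hab : ¬ Commute a b) :
    A = Subgroup.closure {a, b} := by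
  have hle : Subgroup.closure {a, b} ≤ A := by
    rw [Subgroup.closure_le, Set.insert_subset_iff, Set.singleton_subset_iff]
    exact ⟨ha, hb⟩
  by_contra hne
  have hc := (isMinimalNonabelian_subgroup_iff.1 hA).2 _ (lt_of_le_of_ne hle (Ne.symm hne))
  exact hab (Subgroup.isMulCommutative_iff_forall_mem.1 hc a (Subgroup.subset_closure (by simp)) b
    (Subgroup.subset_closure (by simp)))

theorem Subgroup.not_isMulCommutative_closure_pair {G : Type*} [Group G] {x y : G}
    (hxy : ¬ Commute x y) : ¬ IsMulCommutative (Subgroup.closure {x, y}) := fun hc =>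
  hxy (Subgroup.isMulCommutative_iff_forall_mem.1 hc x (Subgroup.subset_closure (by simp)) y
    (Subgroup.subset_closure (by simp)))

/-! ### Structure of `P` when `H` does not centralize it -/

namespace IsOneClassSplit

variable {G : Type*} [Group G] {p : ℕ} {P H : Subgroup G}

theorem commutator_lt [Finite G] (S : IsOneClassSplit p P H) (hp : p.Prime) : ⁅P, P⁆ < P := by
  have := Fact.mk hp
  have hnil := S.isPGroup.isNilpotent
  have hnt : Nontrivial P := by
    by_contra hnt
    rw [not_nontrivial_iff_subsingleton] at hnt
    exact S.not_isMulCommutative ⟨⟨fun a b => Subsingleton.elim _ _⟩⟩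
  have hlt : commutator P < ⊤ := Group.IsSolvable.commutator_lt_top_of_nontrivial P
  refine lt_of_le_of_ne (Subgroup.commutator_le.2 fun x hx y hy =>
    P.mul_mem (P.mul_mem (P.mul_mem hx hy) (P.inv_mem hx)) (P.inv_mem hy)) fun he => ?_
  refine hlt.ne (Subgroup.map_injective P.subtype_injective ?_)
  rw [Subgroup.map_subtype_commutator, he, ← MonoidHom.range_eq_map, Subgroup.range_subtype]

theorem commutatorElement_mem_center [Finite G] (S : IsOneClassSplit p P H) (hp : p.Prime)
    (hne : ∃ h ∈ H, ∃ x ∈ P, ¬ Commute h x) {x y : G} (hx : x ∈ P) (hy : y ∈ P) :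
    ⁅x, y⁆ ∈ Subgroup.center G := by
  have := S.normal
  exact S.le_center_of_lt hp hne inferInstance (S.commutator_lt hp)
    (Subgroup.commutator_mem_commutator hx hy)

/-- Coprime action gives `[G, P] = P`, so `P ≤ G'` lies in the kernel of the transfer `G → P/P'`. On
a central `z ∈ P` this transfer is `z ^ |G : P|`, and the index is prime to `p`. -/
theorem center_inf_le_commutator [Finite G] (S : IsOneClassSplit p P H) (hp : p.Prime)
    (hne : ∃ h ∈ H, ∃ x ∈ P, ¬ Commute h x) : Subgroup.center G ⊓ P ≤ ⁅P, P⁆ := by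
  have := Fact.mk hp
  have := S.normal
  have hPG : ⁅(⊤ : Subgroup G), P⁆ = P := by
    by_contra hPG
    have hlt : ⁅(⊤ : Subgroup G), P⁆ < P := lt_of_le_of_ne (Subgroup.commutator_le_right ⊤ P) hPG
    obtain ⟨h, hh, x, hx, hhx⟩ := hne
    refine hhx (S.commute_of_commute_commutatorElement hx hh ?_)
    exact Subgroup.mem_center_iff.1 (S.le_center_of_lt hp ⟨h, hh, x, hx, hhx⟩ inferInstance hlt
      (Subgroup.commutator_mem_commutator (Subgroup.mem_top h) hx)) h
  have hPc : P ≤ commutator G := by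
    rw [commutator_def]
    exact hPG.ge.trans (Subgroup.commutator_mono le_rfl le_top)
  have hidx : ¬ (p : ℤ) ∣ (P.index : ℤ) := by
    rw [Int.natCast_dvd_natCast, S.isComplement.symm.index_eq_card]
    intro hd
    rcases S.isPGroup.card_eq_or_dvd with h1 | h1
    · have := (Nat.card_eq_one_iff_unique.1 h1).1
      exact S.not_isMulCommutative ⟨⟨fun a b => Subsingleton.elim _ _⟩⟩
    · exact hp.one_lt.ne' (Nat.dvd_one.1 (S.coprime.gcd_eq_one ▸ Nat.dvd_gcd h1 hd))
  rintro z ⟨hzZ, hzP⟩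
  have hV : MonoidHom.transfer (Abelianization.of : P →* Abelianization P) z = 1 :=
    Abelianization.commutator_subset_ker _ (hPc hzP)
  have hkey : ∀ (k : ℕ) (g₀ : G), g₀⁻¹ * z ^ k * g₀ ∈ P → g₀⁻¹ * z ^ k * g₀ = z ^ k := by
    intro k g₀ _
    rw [Subgroup.mem_center_iff.1 (pow_mem hzZ k) g₀⁻¹, inv_mul_cancel_right]
  rw [MonoidHom.transfer_eq_pow _ z hkey, ← MonoidHom.mem_ker, Abelianization.ker_of] at hV
  have h2 : (⟨z, hzP⟩ : P) ∈ commutator P := by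
    refine S.isPGroup.mem_of_zpow_mem hp hidx ?_
    rw [zpow_natCast]
    exact hV
  rw [← Subgroup.map_subtype_commutator]
  exact ⟨_, h2, rfl⟩

theorem pow_mem_center [Finite G] (S : IsOneClassSplit p P H) (hp : p.Prime)
    (hne : ∃ h ∈ H, ∃ x ∈ P, ¬ Commute h x) {x : G} (hx : x ∈ P) : x ^ p ∈ Subgroup.center G := by
  -- Closed under products because `P` is abelian modulo the center of `G`. If it were proper it
  -- would be central, so `P` modulo the center would have no element of order `p`, forcing `P` to
  -- be central.
  let K : Subgroup G :=
    { carrier := {x | x ∈ P ∧ x ^ p ∈ Subgroup.center G}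
      one_mem' := ⟨P.one_mem, by rw [one_pow]; exact one_mem _⟩
      mul_mem' := by
        rintro u v ⟨huP, hu⟩ ⟨hvP, hv⟩
        refine ⟨P.mul_mem huP hvP, ?_⟩
        have hc : Commute (QuotientGroup.mk' (Subgroup.center G) u)
            (QuotientGroup.mk' (Subgroup.center G) v) := by
          rw [← commutatorElement_eq_one_iff_commute, ← map_commutatorElement]
          exact (QuotientGroup.eq_one_iff _).2 (S.commutatorElement_mem_center hp hne huP hvP)
        rw [← QuotientGroup.eq_one_iff, ← QuotientGroup.mk'_apply, map_pow] at hu hv ⊢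
        rw [map_mul, hc.mul_pow, hu, hv, one_mul]
      inv_mem' := by
        rintro u ⟨huP, hu⟩
        exact ⟨P.inv_mem huP, by rw [inv_pow]; exact inv_mem hu⟩ }
  have hKn : K.Normal := by
    refine ⟨fun u hu g => ⟨S.normal.conj_mem u hu.1 g, ?_⟩⟩
    rw [conj_pow]
    exact Subgroup.normal_of_characteristic (Subgroup.center G) |>.conj_mem _ hu.2 g
  have hKP : K ≤ P := fun u hu => hu.1
  by_contra hxp
  have hlt : K < P := lt_of_le_of_ne hKP fun he => hxp (he.ge hx : x ∈ K).2
  have hKZ := S.le_center_of_lt hp hne hKn hlt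
  have hdesc : ∀ n : ℕ, ∀ y ∈ P, y ^ p ^ n ∈ Subgroup.center G → y ∈ Subgroup.center G := by
    intro n
    induction n with
    | zero => intro y _ h; simpa using h
    | succ n ih =>
      intro y hy h
      refine ih y hy (hKZ ⟨P.pow_mem hy _, ?_⟩)
      rwa [← pow_mul, ← pow_succ]
  obtain ⟨n, hn⟩ := S.isPGroup ⟨x, hx⟩
  have hn' : x ^ p ^ n = 1 := congrArg Subtype.val hn
  exact hxp (pow_mem (hdesc n x hx (hn' ▸ one_mem _)) p)

theorem commutatorElement_pow_eq_one [Finite G] (S : IsOneClassSplit p P H) (hp : p.Prime)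
    (hne : ∃ h ∈ H, ∃ x ∈ P, ¬ Commute h x) {x y : G} (hx : x ∈ P) (hy : y ∈ P) :
    ⁅x, y⁆ ^ p = 1 := by
  rw [← commutatorElement_pow_left_of_commute
    (Subgroup.mem_center_iff.1 (S.commutatorElement_mem_center hp hne hx hy) x),
    commutatorElement_eq_one_iff_commute]
  exact (Subgroup.mem_center_iff.1 (S.pow_mem_center hp hne hx) y).symm

theorem orderOf_commutatorElement [Finite G] (S : IsOneClassSplit p P H) (hp : p.Prime)
    (hne : ∃ h ∈ H, ∃ x ∈ P, ¬ Commute h x) {x y : G} (hx : x ∈ P) (hy : y ∈ P)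
    (hxy : ¬ Commute x y) : orderOf ⁅x, y⁆ = p := by
  have := Fact.mk hp
  exact orderOf_eq_prime (S.commutatorElement_pow_eq_one hp hne hx hy)
    (mt commutatorElement_eq_one_iff_commute.1 hxy)

theorem closure_pair_le {x y : G} (hx : x ∈ P) (hy : y ∈ P) : Subgroup.closure {x, y} ≤ P := by
  rw [Subgroup.closure_le, Set.insert_subset_iff, Set.singleton_subset_iff]
  exact ⟨hx, hy⟩

/-- For non-commuting `x, y ∈ P`, the group `⟨x, y⟩` contains a conjugate of `A`. The central
commutator `⁅a, b⁆` is unchanged by conjugation, so it is a power of `⁅x, y⁆`; both have order `p`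
and generate the same subgroup. -/
theorem center_inf_eq_zpowers [Finite G] (S : IsOneClassSplit p P H) (hp : p.Prime)
    (hne : ∃ h ∈ H, ∃ x ∈ P, ¬ Commute h x) {a b : G} (ha : a ∈ P) (hb : b ∈ P)
    (hab : ¬ Commute a b) : Subgroup.center G ⊓ P = Subgroup.zpowers ⁅a, b⁆ := by
  have main : ∀ A : Subgroup G, IsMinimalNonabelian A → ∀ a ∈ A, ∀ b ∈ A, ¬ Commute a b →
      Subgroup.center G ⊓ P ≤ Subgroup.zpowers ⁅a, b⁆ := by
    intro A hA a ha b hb hab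
    have haP := S.le A hA ha
    have hbP := S.le A hA hb
    refine (S.center_inf_le_commutator hp hne).trans (Subgroup.commutator_le.2 fun x hx y hy => ?_)
    by_cases hxy : Commute x y
    · rw [commutatorElement_eq_one_iff_commute.2 hxy]
      exact one_mem _
    have hd := S.commutatorElement_mem_center hp hne hx hy
    obtain ⟨B, hB, hBm⟩ :=
      Subgroup.exists_isMinimalNonabelian_le (Subgroup.not_isMulCommutative_closure_pair hxy)
    obtain ⟨g, hg⟩ := S.conj A B hA hBm
    have h1 : ⁅a, b⁆ ∈ Subgroup.zpowers ⁅x, y⁆ := by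
      have h2 := commutatorElement_mem_of_mem_closure_pair
        (Subgroup.zpowers_normal_of_mem_center hd) (Subgroup.mem_zpowers _)
        (hB ((hg a).1 ha)) (hB ((hg b).1 hb))
      rwa [← conjugate_commutatorElement, Subgroup.mem_center_iff.1
        (S.commutatorElement_mem_center hp hne haP hbP) g, mul_inv_cancel_right] at h2
    have h3 : Subgroup.zpowers ⁅a, b⁆ = Subgroup.zpowers ⁅x, y⁆ := by
      refine Subgroup.eq_of_le_of_card_ge (by rwa [Subgroup.zpowers_le]) ?_
      rw [Nat.card_zpowers, Nat.card_zpowers, S.orderOf_commutatorElement hp hne hx hy hxy,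
        S.orderOf_commutatorElement hp hne haP hbP hab]
    rw [h3]
    exact Subgroup.mem_zpowers _
  have hle : Subgroup.zpowers ⁅a, b⁆ ≤ Subgroup.center G ⊓ P := by
    rw [Subgroup.zpowers_le]
    exact ⟨S.commutatorElement_mem_center hp hne ha hb,
      P.mul_mem (P.mul_mem (P.mul_mem ha hb) (P.inv_mem ha)) (P.inv_mem hb)⟩
  obtain ⟨A, hA, hAm⟩ := Subgroup.exists_isMinimalNonabelian_le S.not_isMulCommutative
  obtain ⟨u, hu, v, hv, huv⟩ := Subgroup.not_isMulCommutative_iff.1 hAm.1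
  refine (Subgroup.eq_of_le_of_card_ge hle ?_).symm
  refine (Subgroup.card_le_of_le (main A hAm u hu v hv huv)).trans ?_
  rw [Nat.card_zpowers, Nat.card_zpowers, S.orderOf_commutatorElement hp hne ha hb hab,
    S.orderOf_commutatorElement hp hne (hA hu) (hA hv) huv]

theorem card_center_inf [Finite G] (S : IsOneClassSplit p P H) (hp : p.Prime)
    (hne : ∃ h ∈ H, ∃ x ∈ P, ¬ Commute h x) :
    Nat.card (Subgroup.center G ⊓ P : Subgroup G) = p := by
  obtain ⟨a, ha, b, hb, hab⟩ := Subgroup.not_isMulCommutative_iff.1 S.not_isMulCommutative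
  rw [S.center_inf_eq_zpowers hp hne ha hb hab, Nat.card_zpowers,
    S.orderOf_commutatorElement hp hne ha hb hab]

theorem center_inf_le_of_mem [Finite G] (S : IsOneClassSplit p P H) (hp : p.Prime)
    (hne : ∃ h ∈ H, ∃ x ∈ P, ¬ Commute h x) {K : Subgroup G} {a b : G} (ha : a ∈ P) (hb : b ∈ P)
    (hab : ¬ Commute a b) (haK : a ∈ K) (hbK : b ∈ K) : Subgroup.center G ⊓ P ≤ K := by
  rw [S.center_inf_eq_zpowers hp hne ha hb hab, Subgroup.zpowers_le]
  exact K.mul_mem (K.mul_mem (K.mul_mem haK hbK) (K.inv_mem haK)) (K.inv_mem hbK)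

theorem conj_mem_iff [Finite G] (S : IsOneClassSplit p P H) (hp : p.Prime)
    (hne : ∃ h ∈ H, ∃ x ∈ P, ¬ Commute h x) {K : Subgroup G} (hK : K ≤ P)
    (hZ : Subgroup.center G ⊓ P ≤ K) {u : G} (hu : u ∈ P) (x : G) :
    x ∈ K ↔ u * x * u⁻¹ ∈ K := by
  have key : ∀ u ∈ P, ∀ x ∈ K, u * x * u⁻¹ ∈ K := by
    intro u hu x hx
    have h1 : ⁅u, x⁆ ∈ K := hZ ⟨S.commutatorElement_mem_center hp hne hu (hK hx),
      P.mul_mem (P.mul_mem (P.mul_mem hu (hK hx)) (P.inv_mem hu)) (P.inv_mem (hK hx))⟩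
    have h2 := K.mul_mem h1 hx
    rwa [commutatorElement_def, inv_mul_cancel_right] at h2
  refine ⟨key u hu x, fun h => ?_⟩
  have := key u⁻¹ (P.inv_mem hu) _ h
  simpa [mul_assoc] using this

/-- In the chain `Z < Z⟨x⟩ < ⟨x, y⟩` each inclusion is strict, and each index is at most `p` because
`p`-th powers lie in `Z`. -/
theorem card_closure_pair [Finite G] (S : IsOneClassSplit p P H) (hp : p.Prime)
    (hne : ∃ h ∈ H, ∃ x ∈ P, ¬ Commute h x) {x y : G} (hx : x ∈ P) (hy : y ∈ P)
    (hxy : ¬ Commute x y) : Nat.card (Subgroup.closure {x, y}) = p ^ 3 := by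
  set Z := Subgroup.center G ⊓ P with hZdef
  have hxK : x ∈ Subgroup.closure {x, y} := Subgroup.subset_closure (by simp)
  have hyK : y ∈ Subgroup.closure {x, y} := Subgroup.subset_closure (by simp)
  have hKP : Subgroup.closure {x, y} ≤ P := closure_pair_le hx hy
  have hZK := S.center_inf_le_of_mem hp hne hx hy hxy hxK hyK
  have hTP : Z ⊔ Subgroup.zpowers x ≤ P := by
    refine sup_le inf_le_right ?_
    rwa [Subgroup.zpowers_le]
  have hxT : x ∈ Z ⊔ Subgroup.zpowers x :=
    (le_sup_right : Subgroup.zpowers x ≤ _) (Subgroup.mem_zpowers x)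
  have hZT : Z ≤ Z ⊔ Subgroup.zpowers x := le_sup_left
  have hxn : x ∈ Subgroup.normalizer (Z : Set G) :=
    Subgroup.mem_normalizer_iff.2 (S.conj_mem_iff hp hne inf_le_right le_rfl hx)
  have hyn : y ∈ Subgroup.normalizer ((Z ⊔ Subgroup.zpowers x : Subgroup G) : Set G) :=
    Subgroup.mem_normalizer_iff.2 (S.conj_mem_iff hp hne hTP hZT hy)
  refine le_antisymm ?_ ?_
  · have h1 := Subgroup.card_sup_zpowers_le hp.pos hxn
      (⟨S.pow_mem_center hp hne hx, P.pow_mem hx p⟩ : x ^ p ∈ Z)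
    have h2 := Subgroup.card_sup_zpowers_le hp.pos hyn
      (hZT ⟨S.pow_mem_center hp hne hy, P.pow_mem hy p⟩)
    have h3 : Subgroup.closure {x, y} ≤ Z ⊔ Subgroup.zpowers x ⊔ Subgroup.zpowers y :=
      closure_pair_le (le_sup_left (a := Z ⊔ Subgroup.zpowers x) hxT)
        ((le_sup_right : Subgroup.zpowers y ≤ _) (Subgroup.mem_zpowers y))
    calc _ ≤ _ := Subgroup.card_le_of_le h3
      _ ≤ _ := h2
      _ ≤ p * (p * p) := by
        rw [S.card_center_inf hp hne] at h1
        exact Nat.mul_le_mul_left p h1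
      _ = p ^ 3 := by ring
  · have h1 : Z < Z ⊔ Subgroup.zpowers x := by
      refine lt_of_le_of_ne hZT fun he => hxy ?_
      exact (Subgroup.mem_center_iff.1 (he.ge hxT).1 y).symm
    have hTc : IsMulCommutative (Z ⊔ Subgroup.zpowers x : Subgroup G) := by
      rw [Subgroup.isMulCommutative_iff_forall_mem]
      intro u hu v hv
      obtain ⟨m, hm, i, rfl⟩ := (Subgroup.mem_sup_zpowers_iff hxn).1 hu
      obtain ⟨n, hn, j, rfl⟩ := (Subgroup.mem_sup_zpowers_iff hxn).1 hv
      have hm' : ∀ g, Commute m g := fun g => (Subgroup.mem_center_iff.1 hm.1 g).symm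
      have hn' : ∀ g, Commute n g := fun g => (Subgroup.mem_center_iff.1 hn.1 g).symm
      exact (hm' _).mul_left ((hn' _).symm.mul_right ((Commute.refl x).zpow_zpow i j))
    have h2 : Z ⊔ Subgroup.zpowers x < Subgroup.closure {x, y} := by
      refine lt_of_le_of_ne (sup_le hZK (by rwa [Subgroup.zpowers_le])) fun he => ?_
      exact Subgroup.not_isMulCommutative_closure_pair hxy (he ▸ hTc)
    have h3 := (S.isPGroup.to_le hTP).mul_card_le_of_lt hp h1
    have h4 := (S.isPGroup.to_le hKP).mul_card_le_of_lt hp h2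
    rw [S.card_center_inf hp hne] at h3
    calc p ^ 3 = p * (p * p) := by ring
      _ ≤ _ := Nat.mul_le_mul_left p h3
      _ ≤ _ := h4

theorem card_of_isMinimalNonabelian [Finite G] (S : IsOneClassSplit p P H) (hp : p.Prime)
    (hne : ∃ h ∈ H, ∃ x ∈ P, ¬ Commute h x) {A : Subgroup G} (hA : IsMinimalNonabelian A) :
    Nat.card A = p ^ 3 := by
  obtain ⟨a, ha, b, hb, hab⟩ := Subgroup.not_isMulCommutative_iff.1 hA.1
  rw [hA.eq_closure_pair ha hb hab]
  exact S.card_closure_pair hp hne (S.le A hA ha) (S.le A hA hb) hab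

theorem center_inf_le [Finite G] (S : IsOneClassSplit p P H) (hp : p.Prime)
    (hne : ∃ h ∈ H, ∃ x ∈ P, ¬ Commute h x) {A : Subgroup G} (hA : IsMinimalNonabelian A) :
    Subgroup.center G ⊓ P ≤ A := by
  obtain ⟨a, ha, b, hb, hab⟩ := Subgroup.not_isMulCommutative_iff.1 hA.1
  exact S.center_inf_le_of_mem hp hne (S.le A hA ha) (S.le A hA hb) hab ha hb

theorem isMinimalNonabelian_closure_pair [Finite G] (S : IsOneClassSplit p P H) (hp : p.Prime)
    (hne : ∃ h ∈ H, ∃ x ∈ P, ¬ Commute h x) {x y : G} (hx : x ∈ P) (hy : y ∈ P)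
    (hxy : ¬ Commute x y) : IsMinimalNonabelian (Subgroup.closure {x, y}) := by
  obtain ⟨B, hB, hBm⟩ :=
    Subgroup.exists_isMinimalNonabelian_le (Subgroup.not_isMulCommutative_closure_pair hxy)
  have : B = Subgroup.closure {x, y} := by
    refine Subgroup.eq_of_le_of_card_ge hB ?_
    rw [S.card_of_isMinimalNonabelian hp hne hBm, S.card_closure_pair hp hne hx hy hxy]
  exact this ▸ hBm

/-- `P` normalizes every minimal non-abelian subgroup, which contains `Z` and hence all commutators
of `P`, so the `P`-part of a conjugating element can be dropped. -/
theorem exists_conj_mem_complement [Finite G] (S : IsOneClassSplit p P H) (hp : p.Prime)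
    (hne : ∃ h ∈ H, ∃ x ∈ P, ¬ Commute h x) {A B : Subgroup G} (hA : IsMinimalNonabelian A)
    (hB : IsMinimalNonabelian B) : ∃ h ∈ H, ∀ x, x ∈ A ↔ h * x * h⁻¹ ∈ B := by
  obtain ⟨g, hg⟩ := S.conj A B hA hB
  obtain ⟨u, hu, h, hh, rfl⟩ := S.exists_mul_eq g
  refine ⟨h, hh, fun x => ?_⟩
  rw [S.conj_mem_iff hp hne (S.le A hA) (S.center_inf_le hp hne hA) (P.inv_mem hu) x, hg]
  simp [mul_assoc]

/-- `C_P(k)` is normalized by the abelian group `H`, and by `P` since it contains `Z`. Being normal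
with a non-central element, it cannot be proper in `P`. -/
theorem commute_of_commute_of_notMem_center [Finite G] (S : IsOneClassSplit p P H) (hp : p.Prime)
    (hne : ∃ h ∈ H, ∃ x ∈ P, ¬ Commute h x) {k a : G} (hk : k ∈ H) (ha : a ∈ P)
    (haZ : a ∉ Subgroup.center G) (hka : Commute k a) {x : G} (hx : x ∈ P) : Commute k x := by
  have hMP : P ⊓ Subgroup.centralizer {k} ≤ P := inf_le_left
  have hmem : ∀ x, x ∈ P ⊓ Subgroup.centralizer {k} ↔ x ∈ P ∧ Commute k x := fun x => by
    rw [Subgroup.mem_inf, Subgroup.mem_centralizer_singleton_iff]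
    exact and_congr_right fun _ => ⟨Eq.symm, Eq.symm⟩
  have hn : (P ⊓ Subgroup.centralizer {k}).Normal := by
    refine S.normal_of_conj_mem (fun u hu x => ?_) fun h hh x hx => ?_
    · refine (S.conj_mem_iff hp hne hMP (fun z hz => ?_) hu x).1
      exact (hmem z).2 ⟨hz.2, Subgroup.mem_center_iff.1 hz.1 k⟩
    · rw [hmem] at hx ⊢
      have hkh := S.commute_of_mem_complement hk hh
      exact ⟨S.normal.conj_mem x hx.1 h, (hkh.mul_right hx.2).mul_right hkh.inv_right⟩
  have he : P ⊓ Subgroup.centralizer {k} = P := by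
    by_contra hlt
    exact haZ (S.le_center_of_lt hp hne hn (lt_of_le_of_ne hMP hlt) ((hmem a).2 ⟨ha, hka⟩))
  exact ((hmem x).1 (he.ge hx)).2

end IsOneClassSplit

/-! ### Two incompatible bounds on the order of `P` -/

namespace IsOneClassSplit

variable {G : Type*} [Group G] {p : ℕ} {P H : Subgroup G}

theorem mem_inf_centralizer_singleton_iff {a x : G} :
    x ∈ P ⊓ Subgroup.centralizer {a} ↔ x ∈ P ∧ Commute a x := by
  rw [Subgroup.mem_inf, Subgroup.mem_centralizer_singleton_iff]
  exact and_congr_right fun _ => ⟨Eq.symm, Eq.symm⟩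

theorem inf_centralizer_singleton_lt {a b : G} (hb : b ∈ P) (hab : ¬ Commute a b) :
    P ⊓ Subgroup.centralizer {a} < P :=
  lt_of_le_of_ne inf_le_left fun he => hab (mem_inf_centralizer_singleton_iff.1 (he.ge hb)).2

/-- With `C = C_P(a) ∩ C_P(b)` one has `P = C⟨a⟩⟨b⟩`. If `C` were abelian it would centralize `P`,
hence lie in `Z ≤ A`, and then `P ≤ A`. -/
theorem inf_centralizer_pair_not_isMulCommutative [Finite G] (S : IsOneClassSplit p P H)
    (hp : p.Prime)
    (hne : ∃ h ∈ H, ∃ x ∈ P, ¬ Commute h x) {A : Subgroup G} (hA : IsMinimalNonabelian A)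
    (hAP : A ≠ P) {a b : G} (ha : a ∈ A) (hb : b ∈ A) (hab : ¬ Commute a b) :
    ¬ IsMulCommutative
      (P ⊓ Subgroup.centralizer {a} ⊓ (P ⊓ Subgroup.centralizer {b}) : Subgroup G) := by
  intro hC
  rw [Subgroup.isMulCommutative_iff_forall_mem] at hC
  set C := P ⊓ Subgroup.centralizer {a} ⊓ (P ⊓ Subgroup.centralizer {b}) with hCdef
  have hmem : ∀ x, x ∈ C ↔ x ∈ P ∧ Commute a x ∧ Commute b x := by
    intro x
    rw [hCdef, Subgroup.mem_inf, mem_inf_centralizer_singleton_iff,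
      mem_inf_centralizer_singleton_iff]
    tauto
  have haP := S.le A hA ha
  have hbP := S.le A hA hb
  have hc := S.commutatorElement_mem_center hp hne haP hbP
  set c := ⁅a, b⁆ with hcdef
  have hcc : ∀ (i : ℤ) (g : G), Commute (c ^ i) g := fun i g =>
    (Subgroup.mem_center_iff.1 (zpow_mem hc i) g).symm
  have hconj_ab : a * b * a⁻¹ = c * b := by rw [hcdef, commutatorElement_def]; group
  have hconj_ba : b * a * b⁻¹ = c⁻¹ * a := by rw [hcdef, commutatorElement_def]; group
  have hdecomp : ∀ y ∈ P, ∃ v ∈ C, ∃ i j : ℤ, y = v * a ^ i * b ^ j := by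
    intro y hy
    have hmemZ : ∀ x ∈ P, ∃ i : ℤ, x * y * x⁻¹ = c ^ i * y := by
      intro x hx
      have h1 : ⁅x, y⁆ ∈ Subgroup.center G ⊓ P :=
        ⟨S.commutatorElement_mem_center hp hne hx hy,
          P.mul_mem (P.mul_mem (P.mul_mem hx hy) (P.inv_mem hx)) (P.inv_mem hy)⟩
      rw [S.center_inf_eq_zpowers hp hne haP hbP hab] at h1
      obtain ⟨i, hi⟩ := h1
      refine ⟨i, ?_⟩
      change c ^ i = ⁅x, y⁆ at hi
      rw [hi, commutatorElement_def, inv_mul_cancel_right]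
    obtain ⟨i, hi⟩ := hmemZ a haP
    obtain ⟨j, hj⟩ := hmemZ b hbP
    have hab' : a * b ^ (-i) * a⁻¹ = c ^ (-i) * b ^ (-i) := by
      rw [← conj_zpow, hconj_ab]
      have := hcc 1 b
      rw [zpow_one] at this
      exact this.mul_zpow _
    have hba' : b * a ^ j * b⁻¹ = c ^ (-j) * a ^ j := by
      rw [← conj_zpow, hconj_ba]
      have := hcc (-1) a
      rw [zpow_neg_one] at this
      rw [this.mul_zpow, inv_zpow']
    -- Conjugation by `a` multiplies `y` by `c ^ i` and `b` by `c`; conjugation by `b` multiplies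
    -- `y` by `c ^ j` and `a` by `c⁻¹`. The exponents are chosen to cancel both factors.
    refine ⟨y * b ^ (-i) * a ^ j, (hmem _).2 ⟨?_, ?_, ?_⟩, -j, i, by group⟩
    · exact P.mul_mem (P.mul_mem hy (P.zpow_mem hbP _)) (P.zpow_mem haP _)
    · have h1 : a * (y * b ^ (-i) * a ^ j) * a⁻¹ =
          (a * y * a⁻¹) * (a * b ^ (-i) * a⁻¹) * a ^ j := by group
      rw [hi, hab', mul_assoc (c ^ i), ← mul_assoc y, ← (hcc (-i) y).eq, mul_assoc (c ^ (-i)),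
        ← mul_assoc (c ^ i), ← zpow_add, add_neg_cancel, zpow_zero, one_mul] at h1
      exact mul_inv_eq_iff_eq_mul.1 h1
    · have h1 : b * (y * b ^ (-i) * a ^ j) * b⁻¹ =
          (b * y * b⁻¹) * b ^ (-i) * (b * a ^ j * b⁻¹) := by group
      have h2 : c ^ j * y * b ^ (-i) * (c ^ (-j) * a ^ j) = y * b ^ (-i) * a ^ j := by
        rw [← mul_assoc (c ^ j * y * b ^ (-i)), ← (hcc (-j) _).eq]
        group
      rw [hj, hba', h2] at h1
      exact mul_inv_eq_iff_eq_mul.1 h1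
  have hCn : (Subgroup.centralizer (P : Set G) ⊓ P).Normal := by
    have := S.normal
    infer_instance
  have hCZ : C ≤ Subgroup.center G := by
    have hlt : Subgroup.centralizer (P : Set G) ⊓ P < P := by
      refine inf_lt_right.2 fun hle => hab ?_
      exact (hle hbP) a haP
    intro u hu
    refine S.le_center_of_lt hp hne hCn hlt (Subgroup.mem_inf.2 ⟨fun y hy => ?_, ((hmem u).1 hu).1⟩)
    obtain ⟨v, hv, i, j, rfl⟩ := hdecomp y hy
    have h1 : Commute v u := hC v hv u hu
    exact (h1.mul_left (((hmem u).1 hu).2.1.zpow_left i)).mul_left (((hmem u).1 hu).2.2.zpow_left j)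
  refine hAP (le_antisymm (S.le A hA) fun y hy => ?_)
  obtain ⟨v, hv, i, j, rfl⟩ := hdecomp y hy
  exact A.mul_mem (A.mul_mem (S.center_inf_le hp hne hA ⟨hCZ hv, ((hmem v).1 hv).1⟩)
    (A.zpow_mem ha i)) (A.zpow_mem hb j)

/-- `C_P(a) ∩ C_P(b)` contains a minimal non-abelian subgroup, of order `p ^ 3`, and the chain up to
`C_P(a)` and `P` has two strict steps. -/
theorem pow_five_le_card [Finite G] (S : IsOneClassSplit p P H) (hp : p.Prime)
    (hne : ∃ h ∈ H, ∃ x ∈ P, ¬ Commute h x) {A : Subgroup G} (hA : IsMinimalNonabelian A)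
    (hAP : A ≠ P) {a b : G} (ha : a ∈ A) (hb : b ∈ A) (hab : ¬ Commute a b) :
    p ^ 5 ≤ Nat.card P := by
  obtain ⟨B, hB, hBm⟩ := Subgroup.exists_isMinimalNonabelian_le
    (S.inf_centralizer_pair_not_isMulCommutative hp hne hA hAP ha hb hab)
  have h1 := Subgroup.card_le_of_le hB
  rw [S.card_of_isMinimalNonabelian hp hne hBm] at h1
  have hlt : P ⊓ Subgroup.centralizer {a} ⊓ (P ⊓ Subgroup.centralizer {b}) <
      P ⊓ Subgroup.centralizer {a} := by
    refine lt_of_le_of_ne inf_le_left fun he => hab ?_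
    have h2 : a ∈ P ⊓ Subgroup.centralizer {a} :=
      mem_inf_centralizer_singleton_iff.2 ⟨S.le A hA ha, Commute.refl a⟩
    exact (mem_inf_centralizer_singleton_iff.1 (he.ge h2).2).2.symm
  have h2 := (S.isPGroup.to_le inf_le_left).mul_card_le_of_lt hp hlt
  have h3 := S.isPGroup.mul_card_le_of_lt hp (inf_centralizer_singleton_lt (S.le A hA hb) hab)
  calc p ^ 5 = p * (p * p ^ 3) := by ring
    _ ≤ p * (p * _) := Nat.mul_le_mul_left p (Nat.mul_le_mul_left p h1)
    _ ≤ p * _ := Nat.mul_le_mul_left p h2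
    _ ≤ _ := h3

theorem card_map_mk_center [Finite G] (S : IsOneClassSplit p P H) (hp : p.Prime)
    (hne : ∃ h ∈ H, ∃ x ∈ P, ¬ Commute h x) {A : Subgroup G} (hA : IsMinimalNonabelian A) :
    Nat.card (A.map (QuotientGroup.mk' (Subgroup.center G))) = p ^ 2 := by
  have hinf : Subgroup.center G ⊓ A = Subgroup.center G ⊓ P :=
    le_antisymm (inf_le_inf_left _ (S.le A hA)) (le_inf inf_le_left (S.center_inf_le hp hne hA))
  have h1 := Subgroup.relIndex_mul_relIndex ⊥ (Subgroup.center G ⊓ A) A bot_le inf_le_right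
  rw [Subgroup.relIndex_bot_left, Subgroup.relIndex_bot_left, Subgroup.inf_relIndex_right, hinf,
    S.card_center_inf hp hne, S.card_of_isMinimalNonabelian hp hne hA] at h1
  rw [← Subgroup.relIndex_ker, QuotientGroup.ker_mk']
  refine Nat.eq_of_mul_eq_mul_left hp.pos (h1.trans (by ring))

theorem ncard_closure_pair_diff_le [Finite G] (S : IsOneClassSplit p P H) (hp : p.Prime)
    (hne : ∃ h ∈ H, ∃ x ∈ P, ¬ Commute h x) {a y : G} (ha : a ∈ P) (hy : y ∈ P)
    (hay : ¬ Commute a y) :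
    ((Subgroup.closure {a, y} : Set G) \ (P ⊓ Subgroup.centralizer {a} : Subgroup G)).ncard ≤
      p ^ 3 - p ^ 2 := by
  set K := Subgroup.closure {a, y}
  have hKP : K ≤ P := closure_pair_le ha hy
  have haK : a ∈ K := Subgroup.subset_closure (by simp)
  have hyK : y ∈ K := Subgroup.subset_closure (by simp)
  have hZ : Subgroup.center G ⊓ P < K ⊓ Subgroup.centralizer {a} := by
    refine lt_of_le_of_ne (fun z hz => ?_) fun he => hay ?_
    · exact mem_inf_centralizer_singleton_iff.2
        ⟨S.center_inf_le_of_mem hp hne ha hy hay haK hyK hz,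
          Subgroup.mem_center_iff.1 hz.1 a⟩
    · have h1 : a ∈ K ⊓ Subgroup.centralizer {a} :=
        mem_inf_centralizer_singleton_iff.2 ⟨haK, Commute.refl a⟩
      exact (Subgroup.mem_center_iff.1 (he.ge h1).1 y).symm
  have h1 := (S.isPGroup.to_le (inf_le_left.trans hKP)).mul_card_le_of_lt hp hZ
  rw [S.card_center_inf hp hne, ← pow_two] at h1
  have h2 : (K : Set G) \ (P ⊓ Subgroup.centralizer {a} : Subgroup G) =
      (K : Set G) \ (K ⊓ Subgroup.centralizer {a} : Subgroup G) := by
    ext x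
    simp only [Set.mem_sdiff, SetLike.mem_coe, Subgroup.mem_inf]
    exact and_congr_right fun hx => by simp [hx, hKP hx]
  have h3 : ((K ⊓ Subgroup.centralizer {a} : Subgroup G) : Set G) ⊆ K :=
    fun x hx => hx.1
  rw [h2, Set.ncard_sdiff h3, ← Nat.card_coe_set_eq, ← Nat.card_coe_set_eq]
  have h4 : Nat.card (K : Set G) = p ^ 3 := S.card_closure_pair hp hne ha hy hay
  rw [h4]
  exact Nat.sub_le_sub_left h1 _

/-- Counting the minimal non-abelian subgroups through a fixed non-central element. -/
theorem ncard_diff_centralizer_le [Finite G] (S : IsOneClassSplit p P H) (hp : p.Prime)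
    (hne : ∃ h ∈ H, ∃ x ∈ P, ¬ Commute h x) {A : Subgroup G} (hA : IsMinimalNonabelian A)
    {a : G} (ha : a ∈ P) (haZ : a ∉ Subgroup.center G) :
    ((P : Set G) \ (P ⊓ Subgroup.centralizer {a} : Subgroup G)).ncard ≤
      (p ^ 3 - p ^ 2) * (p ^ 2 - 1) := by
  classical
  have hs : ∀ y ∈ (P : Set G) \ (P ⊓ Subgroup.centralizer {a} : Subgroup G),
      y ∈ P ∧ ¬ Commute a y := fun y hy =>
    ⟨hy.1, fun hc => hy.2 (mem_inf_centralizer_singleton_iff.2 ⟨hy.1, hc⟩)⟩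
  have hex : ∀ y : G, ∃ h ∈ H, y ∈ (P : Set G) \ (P ⊓ Subgroup.centralizer {a} : Subgroup G) →
      ∀ x, x ∈ A ↔ h * x * h⁻¹ ∈ Subgroup.closure {a, y} := by
    intro y
    by_cases hy : y ∈ (P : Set G) \ (P ⊓ Subgroup.centralizer {a} : Subgroup G)
    · obtain ⟨h, hh, hx⟩ := S.exists_conj_mem_complement hp hne hA
        (S.isMinimalNonabelian_closure_pair hp hne ha (hs y hy).1 (hs y hy).2)
      exact ⟨h, hh, fun _ => hx⟩
    · exact ⟨1, H.one_mem, fun h => absurd h hy⟩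
  choose t htH ht using hex
  have htA : ∀ y ∈ (P : Set G) \ (P ⊓ Subgroup.centralizer {a} : Subgroup G),
      ∀ x ∈ Subgroup.closure {a, y}, (t y)⁻¹ * x * t y ∈ A := by
    intro y hy x hx
    rw [ht y hy]
    simpa [mul_assoc] using hx
  -- Since `t y` conjugates `A` to `⟨a, y⟩`, pulling `a` back gives a non-trivial element of the
  -- image of `A` modulo the center, with `p ^ 2 - 1` possible values.
  set f : G → G ⧸ Subgroup.center G := fun y =>
    QuotientGroup.mk' (Subgroup.center G) ((t y)⁻¹ * a * t y) with hf
  set s : Finset G :=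
    (Set.toFinite ((P : Set G) \ (P ⊓ Subgroup.centralizer {a} : Subgroup G))).toFinset with hsdef
  set T : Finset (G ⧸ Subgroup.center G) := (Set.toFinite
    ((A.map (QuotientGroup.mk' (Subgroup.center G)) : Set (G ⧸ Subgroup.center G)) \ {1})).toFinset
    with hT
  have hTcard : T.card = p ^ 2 - 1 := by
    rw [hT, ← Set.ncard_eq_toFinset_card, Set.ncard_sdiff_singleton_of_mem (one_mem _),
      ← Nat.card_coe_set_eq]
    congr 1
    exact S.card_map_mk_center hp hne hA
  have hfT : ∀ y ∈ s, f y ∈ T := by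
    intro y hy
    rw [hsdef, Set.Finite.mem_toFinset] at hy
    rw [hT, Set.Finite.mem_toFinset]
    refine ⟨⟨_, htA y hy a (Subgroup.subset_closure (by simp)), rfl⟩, fun h1 => haZ ?_⟩
    have h2 : (t y)⁻¹ * a * t y ∈ Subgroup.center G := (QuotientGroup.eq_one_iff _).1 h1
    have h3 := (Subgroup.normal_of_characteristic (Subgroup.center G)).conj_mem _ h2 (t y)
    simpa [mul_assoc] using h3
  -- If `f y = f y₀`, then `k = t y₀ * (t y)⁻¹` in `H` fixes `a` modulo the center, hence fixes `a`,
  -- hence centralizes `P`. Thus `y = k * y * k⁻¹` lies in `⟨a, y₀⟩`, and the fibre lies in `⟨a,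
  -- y₀⟩` minus `C_P(a)`.
  have hfib : ∀ q ∈ T, (s.filter fun y => f y = q).card ≤ p ^ 3 - p ^ 2 := by
    intro q _
    rcases (s.filter fun y => f y = q).eq_empty_or_nonempty with he | ⟨y₀, hy₀⟩
    · rw [he, Finset.card_empty]
      exact Nat.zero_le _
    rw [Finset.mem_filter, hsdef, Set.Finite.mem_toFinset] at hy₀
    obtain ⟨hy₀s, hy₀q⟩ := hy₀
    refine le_trans ?_ (S.ncard_closure_pair_diff_le hp hne ha (hs y₀ hy₀s).1 (hs y₀ hy₀s).2)
    rw [← Set.ncard_coe_finset]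
    refine Set.ncard_le_ncard (fun y hy => ?_) (Set.toFinite _)
    rw [Finset.mem_coe, Finset.mem_filter, hsdef, Set.Finite.mem_toFinset] at hy
    obtain ⟨hys, hyq⟩ := hy
    refine ⟨?_, hys.2⟩
    have hkH : t y₀ * (t y)⁻¹ ∈ H := H.mul_mem (htH y₀) (H.inv_mem (htH y))
    have hka : Commute (t y₀ * (t y)⁻¹) a := by
      refine S.commute_of_commute_commutatorElement ha hkH ?_
      have h1 : ((t y₀)⁻¹ * a * t y₀)⁻¹ * ((t y)⁻¹ * a * t y) ∈ Subgroup.center G :=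
        QuotientGroup.eq.1 (hy₀q.trans hyq.symm)
      have h2 := (Subgroup.normal_of_characteristic (Subgroup.center G)).conj_mem _ h1 (a * t y₀)
      have h3 : ⁅t y₀ * (t y)⁻¹, a⁆ =
          a * t y₀ * (((t y₀)⁻¹ * a * t y₀)⁻¹ * ((t y)⁻¹ * a * t y)) * (a * t y₀)⁻¹ := by
        rw [commutatorElement_def]
        group
      rw [← h3] at h2
      exact Subgroup.mem_center_iff.1 h2 _
    have hky := S.commute_of_commute_of_notMem_center hp hne hkH ha haZ hka hys.1
    have h4 := (ht y₀ hy₀s _).1 (htA y hys y (Subgroup.subset_closure (by simp)))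
    have h5 : t y₀ * ((t y)⁻¹ * y * t y) * (t y₀)⁻¹ = y := by
      have : t y₀ * ((t y)⁻¹ * y * t y) * (t y₀)⁻¹ =
          t y₀ * (t y)⁻¹ * y * (t y₀ * (t y)⁻¹)⁻¹ := by group
      rw [this, hky.eq, mul_inv_cancel_right]
    rwa [h5] at h4
  have := Finset.card_le_mul_card_image_of_maps_to hfT _ hfib
  rwa [hTcard, hsdef, ← Set.ncard_eq_toFinset_card] at this

theorem eq_of_isMinimalNonabelian [Finite G] (S : IsOneClassSplit p P H)
    (hp : p.Prime) {A : Subgroup G}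
    (hA : IsMinimalNonabelian A) : A = P := by
  by_cases hc : ∀ h ∈ H, ∀ x ∈ P, Commute h x
  · exact S.eq_of_forall_commute hp hc hA
  have hne : ∃ h ∈ H, ∃ x ∈ P, ¬ Commute h x := by
    push Not at hc
    exact hc
  by_contra hAP
  obtain ⟨a, ha, b, hb, hab⟩ := Subgroup.not_isMulCommutative_iff.1 hA.1
  have haP := S.le A hA ha
  have hbP := S.le A hA hb
  have h5 := S.pow_five_le_card hp hne hA hAP ha hb hab
  have hle := S.ncard_diff_centralizer_le hp hne hA haP
    (fun h => hab (Subgroup.mem_center_iff.1 h b).symm)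
  have hlt := inf_centralizer_singleton_lt hbP hab
  have hcard := S.isPGroup.mul_card_le_of_lt hp hlt
  have hsum := Set.ncard_sdiff_add_ncard_of_subset (SetLike.coe_subset_coe.2 hlt.le)
    (Set.toFinite (P : Set G))
  rw [← Nat.card_coe_set_eq (P : Set G), ← Nat.card_coe_set_eq (SetLike.coe _)] at hsum
  change _ + Nat.card (P ⊓ Subgroup.centralizer {a} : Subgroup G) = Nat.card P at hsum
  generalize Nat.card P = n at *
  generalize Nat.card (P ⊓ Subgroup.centralizer {a} : Subgroup G) = m at *
  generalize Set.ncard _ = d at *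
  have hp1 := hp.one_lt
  -- Here `n = |P|`, `m = |C_P(a)|` and `d = n - m`, so `p * m ≤ n` gives `(p - 1) * n ≤ p * d`. The
  -- bounds combine to `(p - 1) * p ^ 5 ≤ (p - 1) * p ^ 3 * (p ^ 2 - 1)`, which is absurd.
  obtain ⟨q, rfl⟩ : ∃ q, p = q + 1 := ⟨p - 1, by omega⟩
  have e1 : (q + 1) ^ 3 - (q + 1) ^ 2 = (q + 1) ^ 2 * q := by
    rw [pow_succ (q + 1) 2, ← Nat.mul_sub_one, Nat.add_sub_cancel]
  have e2 : (q + 1) ^ 2 - 1 = q * (q + 2) := by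
    rw [Nat.sub_eq_iff_eq_add (Nat.one_le_pow _ _ (by omega))]
    ring
  rw [e1, e2] at hle
  have h6 : q * n ≤ (q + 1) * d := by nlinarith
  have h7 : q * (q + 1) ^ 5 ≤ (q + 1) * ((q + 1) ^ 2 * q * (q * (q + 2))) :=
    (Nat.mul_le_mul_left q h5).trans (h6.trans (Nat.mul_le_mul_left _ hle))
  have h8 : q * (q + 1) ^ 5 = (q + 1) * ((q + 1) ^ 2 * q * (q * (q + 2))) + q * (q + 1) ^ 3 := by
    ring
  have h9 : 0 < q * (q + 1) ^ 3 := by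
    have : 0 < q := by omega
    positivity
  omega

end IsOneClassSplit

/-! ### Reduction to the split situation and conclusion -/

theorem Sylow.isOneClassSplit {G : Type*} [Group G] [Finite G] {p : ℕ} [Fact p.Prime]
    (P : Sylow p G) (hP : ¬ IsMulCommutative P)
    (hconj : ∀ A B : Subgroup G, IsMinimalNonabelian A → IsMinimalNonabelian B →
      ∃ g : G, ∀ x, x ∈ A ↔ g * x * g⁻¹ ∈ B) :
    ∃ H : Subgroup G, IsOneClassSplit p (P : Subgroup G) H := by
  obtain ⟨A, hAP, hA⟩ := Subgroup.exists_isMinimalNonabelian_le (K := (P : Subgroup G)) hP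
  have hpg : ∀ B : Subgroup G, IsMinimalNonabelian B → IsPGroup p B := by
    intro B hB
    obtain ⟨g, hg⟩ := hconj B A hB hA
    rintro ⟨x, hx⟩
    obtain ⟨n, hn⟩ := P.isPGroup' ⟨_, hAP ((hg x).1 hx)⟩
    refine ⟨n, Subtype.ext ?_⟩
    have h1 : (g * x * g⁻¹) ^ p ^ n = 1 := congrArg Subtype.val hn
    rw [conj_pow, conj_eq_one_iff] at h1
    exact h1
  have hn : (P : Subgroup G).Normal := P.normal_of_forall_exists_isPGroup_le fun K hK => by
    obtain ⟨B, hBK, hB⟩ := Subgroup.exists_isMinimalNonabelian_le hK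
    exact ⟨B, hBK, hpg B hB, hB.1⟩
  have hcop : (Nat.card P).Coprime (P : Subgroup G).index := P.card_coprime_index
  obtain ⟨H, hH⟩ := Subgroup.exists_right_complement'_of_coprime hcop
  refine ⟨H, hn, P.isPGroup', hP, hH, ?_, fun B hB => ?_, hconj⟩
  · rwa [hH.symm.index_eq_card] at hcop
  · obtain ⟨g, hg⟩ := hconj B A hB hA
    intro x hx
    have := hn.conj_mem _ (hAP ((hg x).1 hx)) g⁻¹
    simpa [mul_assoc] using this

theorem exists_conj_of_kappaOne_eq_one {G : Type*} [Group G] (h : kappaOne G = 1)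
    {A B : Subgroup G} (hA : IsMinimalNonabelian A) (hB : IsMinimalNonabelian B) :
    ∃ g : G, ∀ x, x ∈ A ↔ g * x * g⁻¹ ∈ B := by
  obtain ⟨hs, -⟩ := Nat.card_eq_one_iff_unique.1 h
  let A' : minimalNonabelianSubgroups G := ⟨A, hA⟩
  let B' : minimalNonabelianSubgroups G := ⟨B, hB⟩
  have h1 : (Quotient.mk'' B' : MulAction.orbitRel.Quotient (ConjAct G) _) = Quotient.mk'' A' :=
    hs.elim _ _
  obtain ⟨g, hg⟩ := MulAction.orbitRel_apply.1 (Quotient.exact h1)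
  have h2 : g • A = B := congrArg Subtype.val hg
  refine ⟨ConjAct.ofConjAct g, fun x => ?_⟩
  rw [← h2, ← ConjAct.smul_def, Subgroup.smul_mem_pointwise_smul_iff]

theorem theorem2p9 {G : Type*} [Group G] [Finite G]
    (hG : ∃ p : ℕ, p.Prime ∧ ∃ P : Sylow p G, ¬ IsMulCommutative P) :
    kappaOne G = 1 ↔ alphaOne G = 1 := by
  constructor
  · intro h
    obtain ⟨p, hp, P, hP⟩ := hG
    have := Fact.mk hp
    obtain ⟨H, S⟩ := P.isOneClassSplit hP fun A B hA hB => exists_conj_of_kappaOne_eq_one h hA hB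
    obtain ⟨A, -, hA⟩ := Subgroup.exists_isMinimalNonabelian_le (K := (P : Subgroup G)) hP
    refine Nat.card_eq_one_iff_unique.2 ⟨⟨fun B C => Subtype.ext ?_⟩, ⟨⟨A, hA⟩⟩⟩
    exact (S.eq_of_isMinimalNonabelian hp B.2).trans (S.eq_of_isMinimalNonabelian hp C.2).symm
  · intro h
    obtain ⟨hs, ⟨A⟩⟩ := Nat.card_eq_one_iff_unique.1 h
    refine Nat.card_eq_one_iff_unique.2 ⟨⟨fun x y => ?_⟩, ⟨Quotient.mk'' A⟩⟩
    induction x using Quotient.inductionOn'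
    induction y using Quotient.inductionOn'
    exact congrArg _ (hs.elim _ _)
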